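/- All vector spaces are real. Let $A,B,X,Y$ be Banach spaces with continuous and dense inclusions $A\hookrightarrow B$ and $X\hookrightarrow Y$, and let $\mathcal L(Z)$ denote the bounded linear operators on $Z$ with the operator norm. Let $\Phi\colon A\to\mathcal L(X)$ and $\Psi\colon B\to\mathcal L(Y)$ be bounded linear maps such that $\Psi(a)|_X=\Phi(a)$ for all $a\in A$. Then, for every $\theta\in[0,1]$, the restriction of $\Psi$ to the complex interpolation space $[A,B]_\theta$ gives rise to a bounded linear operator $$\Psi\colon [A,B]_\theta\to\mathcal L\bigl([X,Y]_\theta\bigr);$$ that is, for each $c\in[A,B]_\theta$ the operator $\Psi(c)$ maps $[X,Y]_\theta$ into itself, its restriction to $[X,Y]_\theta$ is bounded in the norm of $[X,Y]_\theta$, and this restriction depends boundedly and linearly on $c$. Here, for complex normed spaces $X\hookrightarrow Y$, $[X,Y]_\theta=\{f(\theta)\}$, where $f$ runs through the bounded continuous functions from the strip $0\le\operatorname{Re}z\le1$ to $Y$, holomorphic in its interior, for which $t\mapsto f(it)$ is bounded and continuous with values in $X$; the norm of $y\in[X,Y]_\theta$ is the infimum of $\max\{\sup_t\|f(it)\|_X,\sup_t\|f(1+it)\|_Y\}$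 over all such $f$ with $f(\theta)=y$. For real spaces, $[X,Y]_\theta$ consists of the $y\in Y$ that lie in the interpolation space of the complexified couple, with the norm of that space; complexifications carry the norm $\|x+iy\|=\sup_{t\in\mathbb R}\|(\cos t)\,x-(\sin t)\,y\|$. -/

import Mathlib

noncomputable section

namespace CxInterp

/-! ### Complexification of a real normed space -/

/-- The complexification `E + iE` of a real vector space `E`; the pair `(x, y)` stands for
`x + i y`. -/
def Complexification (E : Type*) : Type _ := E × E

namespace Complexification

set_option linter.unusedSectionVars false

variable {E F : Type*} [NormedAddCommGroup E] [NormedSpace ℝ E]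
  [NormedAddCommGroup F] [NormedSpace ℝ F]

instance : AddCommGroup (Complexification E) := inferInstanceAs (AddCommGroup (E × E))

/-- The real part. -/
def re (p : Complexification E) : E := p.1

/-- The imaginary part. -/
def im (p : Complexification E) : E := p.2

/-- The element `x + i y`. -/
def mk (x y : E) : Complexification E := (x, y)

@[ext] theorem ext {p q : Complexification E} (h1 : p.re = q.re) (h2 : p.im = q.im) : p = q :=
  Prod.ext h1 h2

@[simp] theorem re_mk (x y : E) : (mk x y).re = x := rfl
@[simp] theorem im_mk (x y : E) : (mk x y).im = y := rfl
@[simp] theorem re_add (p q : Complexification E) : (p + q).re = p.re + q.re := rfl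
@[simp] theorem im_add (p q : Complexification E) : (p + q).im = p.im + q.im := rfl
@[simp] theorem re_zero : (0 : Complexification E).re = 0 := rfl
@[simp] theorem im_zero : (0 : Complexification E).im = 0 := rfl

/-- `(a + i b) (x + i y) = (a x - b y) + i (a y + b x)`. -/
instance : SMul ℂ (Complexification E) :=
  ⟨fun z p => mk (z.re • p.re - z.im • p.im) (z.re • p.im + z.im • p.re)⟩

@[simp] theorem re_smul (z : ℂ) (p : Complexification E) :
    (z • p).re = z.re • p.re - z.im • p.im := rfl
@[simp] theorem im_smul (z : ℂ) (p : Complexification E) :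
    (z • p).im = z.re • p.im + z.im • p.re := rfl

instance : Module ℂ (Complexification E) where
  one_smul p := by ext <;> simp
  mul_smul z w p := by
    ext <;> simp only [re_smul, im_smul, Complex.mul_re, Complex.mul_im] <;> module
  smul_zero z := by ext <;> simp
  smul_add z p q := by
    ext <;> simp only [re_smul, im_smul, re_add, im_add] <;> module
  add_smul z w p := by
    ext <;> simp only [re_smul, im_smul, re_add, im_add, Complex.add_re, Complex.add_im] <;> module
  zero_smul p := by ext <;> simp

/-- The bounded real-linear map `w ↦ Re (w (x + i y))` attached to `x + i y`. -/
def rotCLM (p : Complexification E) : ℂ →L[ℝ] E :=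
  Complex.reCLM.smulRight p.re - Complex.imCLM.smulRight p.im

@[simp] theorem rotCLM_apply (p : Complexification E) (w : ℂ) :
    rotCLM p w = w.re • p.re - w.im • p.im := rfl

/-- `rotCLM` as an additive map. -/
def rotHom : Complexification E →+ (ℂ →L[ℝ] E) where
  toFun := rotCLM
  map_zero' := by ext w; simp
  map_add' p q := by
    ext w; simp only [rotCLM_apply, re_add, im_add, add_apply]; module

theorem rotHom_injective : Function.Injective (rotHom (E := E)) := by
  intro p q h
  have h1 := congrArg (fun T : ℂ →L[ℝ] E => T 1) h
  have h2 := congrArg (fun T : ℂ →L[ℝ] E => T Complex.I) h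
  ext
  · simpa [rotHom] using h1
  · simpa [rotHom] using h2

/-- The (Taylor) norm of the complexification,
`‖x + i y‖ = sup_{|w| ≤ 1} ‖Re (w (x + i y))‖ = sup_t ‖(cos t) x - (sin t) y‖`. -/
instance : NormedAddCommGroup (Complexification E) :=
  NormedAddCommGroup.induced (Complexification E) (ℂ →L[ℝ] E) rotHom rotHom_injective

theorem norm_def (p : Complexification E) : ‖p‖ = ‖rotCLM p‖ := rfl

instance : NormedSpace ℂ (Complexification E) where
  norm_smul_le z p := by
    rw [norm_def, norm_def]
    refine ContinuousLinearMap.opNorm_le_bound _ (by positivity) fun w => ?_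
    have h : rotCLM (z • p) w = rotCLM p (z * w) := by
      simp only [rotCLM_apply, re_smul, im_smul, Complex.mul_re, Complex.mul_im]
      module
    rw [h]
    calc ‖rotCLM p (z * w)‖ ≤ ‖rotCLM p‖ * ‖z * w‖ := (rotCLM p).le_opNorm _
      _ = ‖z‖ * ‖rotCLM p‖ * ‖w‖ := by rw [norm_mul]; ring

/-- The embedding `x ↦ x + i 0`. -/
def ofReal : E →ₗ[ℝ] Complexification E where
  toFun x := mk x 0
  map_add' x y := by ext <;> simp
  map_smul' r x := by
    change mk (r • x) 0 = (r : ℂ) • mk x 0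
    ext <;> simp only [re_smul, im_smul, re_mk, im_mk, Complex.ofReal_re, Complex.ofReal_im] <;>
      module

theorem ofReal_injective : Function.Injective (ofReal (E := E)) :=
  fun _ _ h => congrArg re h

/-- The complex-linear extension `x + i y ↦ T x + i T y` of a bounded real-linear map `T`. -/
def map (T : E →L[ℝ] F) : Complexification E →L[ℂ] Complexification F :=
  LinearMap.mkContinuous
    { toFun := fun p => mk (T p.re) (T p.im)
      map_add' := fun p q => by ext <;> simp
      map_smul' := fun z p => by ext <;> simp } ‖T‖ fun p => by
    rw [norm_def, norm_def]
    refine ContinuousLinearMap.opNorm_le_bound _ (by positivity) fun w => ?_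
    have h : rotCLM (mk (T p.re) (T p.im)) w = T (rotCLM p w) := by simp
    calc ‖rotCLM (mk (T p.re) (T p.im)) w‖ = ‖T (rotCLM p w)‖ := by rw [h]
      _ ≤ ‖T‖ * ‖rotCLM p w‖ := T.le_opNorm _
      _ ≤ ‖T‖ * (‖rotCLM p‖ * ‖w‖) := by gcongr; exact (rotCLM p).le_opNorm _
      _ = ‖T‖ * ‖rotCLM p‖ * ‖w‖ := by ring

end Complexification

/-! ### The complex method for a couple of complex spaces `X ↪ Y` -/

open Complex.HadamardThreeLines in
/-- `f` belongs to the Calderón space of the couple `i : X ↪ Y`, with Calderón norm at most `M`: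
`f` is bounded and continuous on the closed strip `0 ≤ Re z ≤ 1` with values in `Y`
(which is `X + Y`, as `X ↪ Y`), holomorphic in its interior, `t ↦ f (i t)` is a continuous
function with values in `X` bounded by `M`, and `t ↦ f (1 + i t)` is bounded by `M` in `Y`.
Values of `f` outside the closed strip play no role. -/
structure IsCalderon {X Y : Type*} [NormedAddCommGroup X] [NormedSpace ℂ X]
    [NormedAddCommGroup Y] [NormedSpace ℂ Y] (i : X →L[ℂ] Y) (f : ℂ → Y) (M : ℝ) : Prop where
  diffContOnCl : DiffContOnCl ℂ f (verticalStrip 0 1)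
  bounded : ∃ C : ℝ, ∀ z ∈ verticalClosedStrip 0 1, ‖f z‖ ≤ C
  left : ∃ g : ℝ → X, Continuous g ∧ ∀ t : ℝ, i (g t) = f (t * Complex.I) ∧ ‖g t‖ ≤ M
  right : ∀ t : ℝ, ‖f (1 + t * Complex.I)‖ ≤ M

section Complex

variable {X Y : Type*} [NormedAddCommGroup X] [NormedSpace ℂ X]
  [NormedAddCommGroup Y] [NormedSpace ℂ Y]

theorem IsCalderon.nonneg {i : X →L[ℂ] Y} {f : ℂ → Y} {M : ℝ} (h : IsCalderon i f M) : 0 ≤ M :=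
  (norm_nonneg _).trans (h.right 0)

theorem IsCalderon.zero (i : X →L[ℂ] Y) : IsCalderon i (fun _ => 0) 0 where
  diffContOnCl := diffContOnCl_const
  bounded := ⟨0, by simp⟩
  left := ⟨fun _ => 0, continuous_const, by simp⟩
  right := by simp

theorem IsCalderon.add {i : X →L[ℂ] Y} {f f' : ℂ → Y} {M M' : ℝ}
    (h : IsCalderon i f M) (h' : IsCalderon i f' M') :
    IsCalderon i (fun z => f z + f' z) (M + M') where
  diffContOnCl := h.diffContOnCl.add h'.diffContOnCl
  bounded := by
    obtain ⟨C, hC⟩ := h.bounded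
    obtain ⟨C', hC'⟩ := h'.bounded
    exact ⟨C + C', fun z hz => (norm_add_le _ _).trans (add_le_add (hC z hz) (hC' z hz))⟩
  left := by
    obtain ⟨g, hg, hgf⟩ := h.left
    obtain ⟨g', hg', hgf'⟩ := h'.left
    refine ⟨fun t => g t + g' t, hg.add hg', fun t => ⟨?_, ?_⟩⟩
    · rw [map_add, (hgf t).1, (hgf' t).1]
    · exact (norm_add_le _ _).trans (add_le_add (hgf t).2 (hgf' t).2)
  right t := (norm_add_le _ _).trans (add_le_add (h.right t) (h'.right t))

theorem IsCalderon.smul {i : X →L[ℂ] Y} {f : ℂ → Y} {M : ℝ} (c : ℂ) (h : IsCalderon i f M) :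
    IsCalderon i (fun z => c • f z) (‖c‖ * M) where
  diffContOnCl := h.diffContOnCl.const_smul c
  bounded := by
    obtain ⟨C, hC⟩ := h.bounded
    refine ⟨‖c‖ * C, fun z hz => ?_⟩
    rw [norm_smul]
    exact mul_le_mul_of_nonneg_left (hC z hz) (norm_nonneg c)
  left := by
    obtain ⟨g, hg, hgf⟩ := h.left
    refine ⟨fun t => c • g t, hg.const_smul c, fun t => ⟨?_, ?_⟩⟩
    · rw [map_smul, (hgf t).1]
    · rw [norm_smul]
      exact mul_le_mul_of_nonneg_left (hgf t).2 (norm_nonneg c)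
  right t := by
    rw [norm_smul]
    exact mul_le_mul_of_nonneg_left (h.right t) (norm_nonneg c)

open Complex.HadamardThreeLines in
/-- The Calderón norm dominates the norm of `Y` on the strip (maximum principle). -/
theorem IsCalderon.norm_apply_le {i : X →L[ℂ] Y} {f : ℂ → Y} {M : ℝ} (h : IsCalderon i f M)
    {z : ℂ} (hz : z ∈ verticalClosedStrip 0 1) : ‖f z‖ ≤ max ‖i‖ 1 * M := by
  have hM := h.nonneg
  have hK : 0 ≤ max ‖i‖ 1 * M := by positivity
  have hB : BddAbove ((norm ∘ f) '' verticalClosedStrip 0 1) := by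
    obtain ⟨C, hC⟩ := h.bounded
    refine ⟨C, ?_⟩
    rintro _ ⟨w, hw, rfl⟩
    exact hC w hw
  have key := norm_le_interp_of_mem_verticalClosedStrip₀₁' f (a := max ‖i‖ 1 * M)
    (b := max ‖i‖ 1 * M) hz h.diffContOnCl hB ?_ ?_
  · refine key.trans (le_of_eq ?_)
    rw [← Real.rpow_add_of_nonneg hK (sub_nonneg.mpr hz.2) hz.1]
    simp
  · intro w hw
    obtain ⟨g, -, hg⟩ := h.left
    have hw' : (w.im : ℂ) * Complex.I = w := by
      apply Complex.ext <;> simp_all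
    have h1 := hg w.im
    rw [hw'] at h1
    rw [← h1.1]
    calc ‖i (g w.im)‖ ≤ ‖i‖ * ‖g w.im‖ := i.le_opNorm _
      _ ≤ max ‖i‖ 1 * M := mul_le_mul (le_max_left _ _) h1.2 (norm_nonneg _) (by positivity)
  · intro w hw
    have hw' : 1 + (w.im : ℂ) * Complex.I = w := by
      apply Complex.ext <;> simp_all
    have h1 := h.right w.im
    rw [hw'] at h1
    exact h1.trans (le_mul_of_one_le_left hM (le_max_right _ _))

/-- The complex interpolation space `[X, Y]_θ` as a subspace of `Y`: all values `f θ` of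
functions `f` of the Calderón space. -/
def interpSubmodule (i : X →L[ℂ] Y) (θ : Set.Icc (0 : ℝ) 1) : Submodule ℂ Y where
  carrier := {y | ∃ (f : ℂ → Y) (M : ℝ), IsCalderon i f M ∧ f ((θ : ℝ) : ℂ) = y}
  zero_mem' := ⟨_, _, IsCalderon.zero i, rfl⟩
  add_mem' := by
    rintro _ _ ⟨f, M, h, rfl⟩ ⟨f', M', h', rfl⟩
    exact ⟨_, _, h.add h', rfl⟩
  smul_mem' := by
    rintro c _ ⟨f, M, h, rfl⟩
    exact ⟨_, _, h.smul c, rfl⟩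

/-- The complex interpolation space `[X, Y]_θ`, with its own norm (see below; it is not the norm
inherited from `Y`). -/
def ComplexInterp (i : X →L[ℂ] Y) (θ : Set.Icc (0 : ℝ) 1) : Type _ := ↥(interpSubmodule i θ)

namespace ComplexInterp

variable (i : X →L[ℂ] Y) (θ : Set.Icc (0 : ℝ) 1)

instance : AddCommGroup (ComplexInterp i θ) := inferInstanceAs (AddCommGroup (interpSubmodule i θ))

instance : Module ℂ (ComplexInterp i θ) := inferInstanceAs (Module ℂ (interpSubmodule i θ))

variable {i θ}

/-- The inclusion `[X, Y]_θ ⊆ Y`. -/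
def incl : ComplexInterp i θ →ₗ[ℂ] Y := (interpSubmodule i θ).subtype

theorem incl_injective : Function.Injective (incl (i := i) (θ := θ)) :=
  Subtype.val_injective

/-- The upper bounds for the Calderón norms of the functions `f` with `f θ = y`. -/
def bounds (y : ComplexInterp i θ) : Set ℝ :=
  {M | ∃ f : ℂ → Y, IsCalderon i f M ∧ f ((θ : ℝ) : ℂ) = incl y}

theorem bounds_nonempty (y : ComplexInterp i θ) : (bounds y).Nonempty := by
  obtain ⟨f, M, h⟩ := y.2
  exact ⟨M, f, h⟩

theorem bounds_nonneg (y : ComplexInterp i θ) : ∀ M ∈ bounds y, 0 ≤ M := by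
  rintro M ⟨f, h, -⟩
  exact h.nonneg

theorem bounds_bddBelow (y : ComplexInterp i θ) : BddBelow (bounds y) := ⟨0, bounds_nonneg y⟩

/-- The norm of `[X, Y]_θ`: the infimum of the Calderón norms of the functions `f` in the
Calderón space with `f θ = y`. -/
def interpNorm (y : ComplexInterp i θ) : ℝ := sInf (bounds y)

theorem interpNorm_nonneg (y : ComplexInterp i θ) : 0 ≤ interpNorm y :=
  Real.sInf_nonneg (bounds_nonneg y)

theorem interpNorm_smul_le (c : ℂ) (y : ComplexInterp i θ) :
    interpNorm (c • y) ≤ ‖c‖ * interpNorm y := by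
  have key : ∀ M ∈ bounds y, interpNorm (c • y) ≤ ‖c‖ * M := by
    rintro M ⟨f, h, hf⟩
    exact csInf_le (bounds_bddBelow _) ⟨_, h.smul c, by simp [hf]⟩
  rcases (norm_nonneg c).eq_or_lt with hc | hc
  · obtain ⟨M, hM⟩ := bounds_nonempty y
    have := key M hM
    rw [← hc] at this ⊢
    simpa using this
  · rw [mul_comm, ← div_le_iff₀ hc]
    refine le_csInf (bounds_nonempty y) fun M hM => ?_
    rw [div_le_iff₀ hc, mul_comm]
    exact key M hM

/-- `interpNorm` is a norm. -/
def addGroupNorm : AddGroupNorm (ComplexInterp i θ) where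
  toFun := interpNorm
  map_zero' := le_antisymm
    (csInf_le (bounds_bddBelow _) ⟨_, IsCalderon.zero i, (map_zero _).symm⟩) (interpNorm_nonneg _)
  add_le' x y := by
    refine le_of_forall_pos_lt_add fun ε hε => ?_
    obtain ⟨M, ⟨f, h, hf⟩, hM⟩ := exists_lt_of_csInf_lt (bounds_nonempty x)
      (show sInf (bounds x) < interpNorm x + ε / 2 by unfold interpNorm; linarith)
    obtain ⟨M', ⟨f', h', hf'⟩, hM'⟩ := exists_lt_of_csInf_lt (bounds_nonempty y)
      (show sInf (bounds y) < interpNorm y + ε / 2 by unfold interpNorm; linarith)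
    have : interpNorm (x + y) ≤ M + M' :=
      csInf_le (bounds_bddBelow _) ⟨_, h.add h', by simp [hf, hf']⟩
    linarith
  neg' x := by
    have key : ∀ y : ComplexInterp i θ, interpNorm (-y) ≤ interpNorm y := fun y => by
      simpa using interpNorm_smul_le (-1) y
    exact le_antisymm (key x) (by simpa using key (-x))
  eq_zero_of_map_eq_zero' x hx := by
    have hK : 0 < max ‖i‖ 1 := lt_max_of_lt_right one_pos
    have h1 : ‖incl x‖ / max ‖i‖ 1 ≤ interpNorm x := by
      refine le_csInf (bounds_nonempty x) ?_
      rintro M ⟨f, h, hf⟩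
      rw [div_le_iff₀ hK, mul_comm, ← hf]
      exact h.norm_apply_le ⟨by simpa using θ.2.1, by simpa using θ.2.2⟩
    have hx' : interpNorm x = 0 := hx
    rw [hx', div_le_iff₀ hK, zero_mul, norm_le_zero_iff] at h1
    exact incl_injective (h1.trans (map_zero _).symm)

instance : NormedAddCommGroup (ComplexInterp i θ) := addGroupNorm.toNormedAddCommGroup

theorem norm_def (y : ComplexInterp i θ) : ‖y‖ = sInf (bounds y) := rfl

instance : NormedSpace ℂ (ComplexInterp i θ) where
  norm_smul_le := interpNorm_smul_le

end ComplexInterp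

end Complex

/-! ### The complex method for a couple of real spaces `X ↪ Y` -/

section Real

variable {X Y : Type*} [NormedAddCommGroup X] [NormedSpace ℝ X]
  [NormedAddCommGroup Y] [NormedSpace ℝ Y]

/-- The complex interpolation space `[X, Y]_θ` of real spaces `X ↪ Y`, as a subspace of `Y`:
the real part of the complex interpolation space of the complexified couple. -/
def realInterpSubmodule (i : X →L[ℝ] Y) (θ : Set.Icc (0 : ℝ) 1) : Submodule ℝ Y :=
  ((interpSubmodule (Complexification.map i) θ).restrictScalars ℝ).comap Complexification.ofReal

/-- The complex interpolation space `[X, Y]_θ` of real spaces `X ↪ Y`, with its own norm, the one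
of the complex interpolation space of the complexified couple. -/
def Interp (i : X →L[ℝ] Y) (θ : Set.Icc (0 : ℝ) 1) : Type _ := ↥(realInterpSubmodule i θ)

namespace Interp

variable (i : X →L[ℝ] Y) (θ : Set.Icc (0 : ℝ) 1)

instance : AddCommGroup (Interp i θ) := inferInstanceAs (AddCommGroup (realInterpSubmodule i θ))

instance : Module ℝ (Interp i θ) := inferInstanceAs (Module ℝ (realInterpSubmodule i θ))

variable {i θ}

/-- The inclusion `[X, Y]_θ ⊆ Y`. -/
def incl : Interp i θ →ₗ[ℝ] Y := (realInterpSubmodule i θ).subtype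

/-- The embedding of `[X, Y]_θ` into the interpolation space of the complexified couple. -/
def toComplex : Interp i θ →ₗ[ℝ] ComplexInterp (Complexification.map i) θ where
  toFun y := ⟨Complexification.ofReal (incl y), y.2⟩
  map_add' x y := Subtype.ext (by simp; rfl)
  map_smul' r x := Subtype.ext (by simp; rfl)

theorem toComplex_injective : Function.Injective (toComplex (i := i) (θ := θ)) := fun _ _ h =>
  Subtype.ext (Complexification.ofReal_injective (congrArg Subtype.val h))

instance : NormedAddCommGroup (Interp i θ) :=
  NormedAddCommGroup.induced (Interp i θ) (ComplexInterp (Complexification.map i) θ) toComplex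
    toComplex_injective

theorem norm_def (y : Interp i θ) : ‖y‖ = ‖toComplex y‖ := rfl

instance : NormedSpace ℝ (Interp i θ) where
  norm_smul_le r y := by
    rw [norm_def, norm_def, map_smul]
    exact norm_smul_le r (toComplex y)

end Interp

end Real

end CxInterp

end

/-! A bounded linear map into operators is a bounded bilinear map in curried form, so the claim is
that the complex method interpolates bilinear maps. Let `T` be bounded bilinear on the larger spaces
and restrict to a bounded bilinear `S` on the smaller ones. If `f`, `g` are Calderón functions with
values `c`, `z` at `θ`, then the pointwise product `T (f ·) (g ·)` is one with value `T c z`: it is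
holomorphic by the product rule, its values on the left edge come from `S`, and its Calderón norm is
at most `max ‖S‖ ‖T‖` times the product of those of `f` and `g` (`IsCalderon.bilin`). Infima over
`f` and `g` give the norm estimate.

Real couples reduce to this by extending `S` and `T` complex-bilinearly: compatibility survives
(`Complexification.bilin_map`), and real arguments give real values (`bilin_ofReal`). -/

noncomputable section

namespace CxInterp

/-! ### Complexifying bounded bilinear maps. -/

namespace Complexification

variable {E F G : Type*} [NormedAddCommGroup E] [NormedSpace ℝ E]
  [NormedAddCommGroup F] [NormedSpace ℝ F] [NormedAddCommGroup G] [NormedSpace ℝ G]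

theorem norm_re_le (p : Complexification E) : ‖p.re‖ ≤ ‖p‖ := by
  simpa [norm_def] using (rotCLM p).le_opNorm 1

theorem norm_im_le (p : Complexification E) : ‖p.im‖ ≤ ‖p‖ := by
  simpa [norm_def] using (rotCLM p).le_opNorm Complex.I

theorem norm_le_re_add_im (p : Complexification E) : ‖p‖ ≤ ‖p.re‖ + ‖p.im‖ := by
  rw [norm_def]
  refine ContinuousLinearMap.opNorm_le_bound _ (by positivity) fun w => ?_
  calc ‖rotCLM p w‖ ≤ ‖w.re • p.re‖ + ‖w.im • p.im‖ := norm_sub_le _ _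
    _ = |w.re| * ‖p.re‖ + |w.im| * ‖p.im‖ := by
      rw [norm_smul, norm_smul, Real.norm_eq_abs, Real.norm_eq_abs]
    _ ≤ ‖w‖ * ‖p.re‖ + ‖w‖ * ‖p.im‖ := by
      gcongr
      exacts [Complex.abs_re_le_norm w, Complex.abs_im_le_norm w]
    _ = (‖p.re‖ + ‖p.im‖) * ‖w‖ := by ring

/-- The complex-bilinear extension of a bounded real-bilinear map. -/
def bilin (T : E →L[ℝ] F →L[ℝ] G) :
    Complexification E →L[ℂ] Complexification F →L[ℂ] Complexification G :=
  LinearMap.mkContinuous₂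
    (LinearMap.mk₂ ℂ
      (fun p q => mk (T p.re q.re - T p.im q.im) (T p.re q.im + T p.im q.re))
      (fun p p' q => by
        ext <;> simp only [re_mk, im_mk, re_add, im_add, map_add, add_apply] <;> module)
      (fun c p q => by
        ext <;> simp only [re_mk, im_mk, re_smul, im_smul, map_add, map_sub, map_smul,
          add_apply, sub_apply, smul_apply] <;> module)
      (fun p q q' => by
        ext <;> simp only [re_mk, im_mk, re_add, im_add, map_add] <;> module)
      (fun c p q => by
        ext <;> simp only [re_mk, im_mk, re_smul, im_smul, map_add, map_sub, map_smul] <;> module))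
    -- The real and imaginary parts consist of two terms each, and each of the four is at most `‖T‖
    -- * ‖p‖ * ‖q‖`.
    (4 * ‖T‖) fun p q => by
      have hT : ∀ x y, ‖x‖ ≤ ‖p‖ → ‖y‖ ≤ ‖q‖ → ‖T x y‖ ≤ ‖T‖ * ‖p‖ * ‖q‖ :=
        fun x y hx hy => (T.le_opNorm₂ x y).trans (by gcongr)
      have h1 := hT _ _ (norm_re_le p) (norm_re_le q)
      have h2 := hT _ _ (norm_im_le p) (norm_im_le q)
      have h3 := hT _ _ (norm_re_le p) (norm_im_le q)
      have h4 := hT _ _ (norm_im_le p) (norm_re_le q)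
      have h5 := norm_sub_le (T p.re q.re) (T p.im q.im)
      have h6 := norm_add_le (T p.re q.im) (T p.im q.re)
      refine (norm_le_re_add_im _).trans ?_
      simp only [LinearMap.mk₂_apply, re_mk, im_mk]
      linarith

theorem bilin_apply (T : E →L[ℝ] F →L[ℝ] G) (p : Complexification E) (q : Complexification F) :
    bilin T p q = mk (T p.re q.re - T p.im q.im) (T p.re q.im + T p.im q.re) := rfl

theorem bilin_ofReal (T : E →L[ℝ] F →L[ℝ] G) (x : E) (y : F) :
    bilin T (ofReal x) (ofReal y) = ofReal (T x y) := by
  ext <;> simp [bilin_apply, ofReal]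

theorem map_apply (T : E →L[ℝ] F) (p : Complexification E) :
    map T p = mk (T p.re) (T p.im) := rfl

end Complexification

/-! ### Bilinear interpolation for complex couples. -/

section Complex

variable {A B X Y V W : Type*}
  [NormedAddCommGroup A] [NormedSpace ℂ A] [NormedAddCommGroup B] [NormedSpace ℂ B]
  [NormedAddCommGroup X] [NormedSpace ℂ X] [NormedAddCommGroup Y] [NormedSpace ℂ Y]
  [NormedAddCommGroup V] [NormedSpace ℂ V] [NormedAddCommGroup W] [NormedSpace ℂ W]
  {i : A →L[ℂ] B} {j : X →L[ℂ] Y} {k : V →L[ℂ] W}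

/-- A bounded bilinear map of couples acts on the Calderón spaces pointwise. -/
theorem IsCalderon.bilin (S : A →L[ℂ] X →L[ℂ] V) (T : B →L[ℂ] Y →L[ℂ] W)
    (hST : ∀ a x, T (i a) (j x) = k (S a x)) {f : ℂ → B} {g : ℂ → Y} {M N : ℝ}
    (hf : IsCalderon i f M) (hg : IsCalderon j g N) :
    IsCalderon k (fun z => T (f z) (g z)) (max ‖S‖ ‖T‖ * M * N) where
  diffContOnCl :=
    ⟨fun z hz => ((T.differentiableAt.comp_differentiableWithinAt z
        (hf.diffContOnCl.differentiableOn z hz)).clm_apply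
        (hg.diffContOnCl.differentiableOn z hz)),
      (T.continuous.comp_continuousOn hf.diffContOnCl.continuousOn).clm_apply
        hg.diffContOnCl.continuousOn⟩
  bounded := by
    obtain ⟨C, hC⟩ := hf.bounded
    obtain ⟨D, hD⟩ := hg.bounded
    refine ⟨‖T‖ * C * D, fun z hz => (T.le_opNorm₂ _ _).trans ?_⟩
    -- This is `0 ≤ C`, needed for monotonicity of the product.
    have := (norm_nonneg _).trans (hC z hz)
    gcongr
    exacts [hC z hz, hD z hz]
  left := by
    obtain ⟨u, hu, huf⟩ := hf.left
    obtain ⟨v, hv, hvg⟩ := hg.left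
    -- The smaller spaces' map `S` lifts the left boundary values to `V`; `hST` says that the lift
    -- is the right one.
    refine ⟨fun t => S (u t) (v t), (S.continuous.comp hu).clm_apply hv, fun t => ⟨?_, ?_⟩⟩
    · rw [← hST, (huf t).1, (hvg t).1]
    · refine (S.le_opNorm₂ _ _).trans ?_
      have := hf.nonneg
      gcongr
      exacts [le_max_left _ _, (huf t).2, (hvg t).2]
  right t := by
    refine (T.le_opNorm₂ _ _).trans ?_
    have := hf.nonneg
    gcongr
    exacts [le_max_right _ _, hf.right t, hg.right t]

namespace ComplexInterp

variable {θ : Set.Icc (0 : ℝ) 1}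

theorem bilin_mem (S : A →L[ℂ] X →L[ℂ] V) (T : B →L[ℂ] Y →L[ℂ] W)
    (hST : ∀ a x, T (i a) (j x) = k (S a x)) (c : ComplexInterp i θ) (z : ComplexInterp j θ) :
    T (incl c) (incl z) ∈ interpSubmodule k θ := by
  obtain ⟨M, f, hf, hfc⟩ := bounds_nonempty c
  obtain ⟨N, g, hg, hgz⟩ := bounds_nonempty z
  exact ⟨_, _, hf.bilin S T hST hg, by simp only [hfc, hgz]⟩

/-- Interpolation of bounded bilinear maps by the complex method: the norm estimate. -/
theorem norm_le_of_incl_eq (S : A →L[ℂ] X →L[ℂ] V) (T : B →L[ℂ] Y →L[ℂ] W)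
    (hST : ∀ a x, T (i a) (j x) = k (S a x)) (c : ComplexInterp i θ) (z : ComplexInterp j θ)
    (w : ComplexInterp k θ) (hw : incl w = T (incl c) (incl z)) :
    ‖w‖ ≤ max ‖S‖ ‖T‖ * ‖c‖ * ‖z‖ := by
  have key : ∀ M ∈ bounds c, ∀ N ∈ bounds z, ‖w‖ ≤ max ‖S‖ ‖T‖ * M * N := by
    rintro M ⟨f, hf, hfc⟩ N ⟨g, hg, hgz⟩
    exact csInf_le (bounds_bddBelow w) ⟨_, hf.bilin S T hST hg, by simp only [hfc, hgz, hw]⟩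
  -- The infima need not be attained, so both are approached within `1 / (n + 1)` and the limit is
  -- taken in the product bound.
  have lim : ∀ r : ℝ, Filter.Tendsto (fun n : ℕ => r + 1 / ((n : ℝ) + 1)) Filter.atTop (nhds r) :=
    fun r => by simpa using tendsto_const_nhds.add (tendsto_one_div_add_atTop_nhds_zero_nat (𝕜 := ℝ))
  refine ge_of_tendsto' (((lim ‖c‖).const_mul (max ‖S‖ ‖T‖)).mul (lim ‖z‖)) fun n => ?_
  obtain ⟨M, hM, hMn⟩ := exists_lt_of_csInf_lt (bounds_nonempty c)
    (show sInf (bounds c) < ‖c‖ + 1 / ((n : ℝ) + 1) from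
      lt_add_of_pos_right _ Nat.one_div_pos_of_nat)
  obtain ⟨N, hN, hNn⟩ := exists_lt_of_csInf_lt (bounds_nonempty z)
    (show sInf (bounds z) < ‖z‖ + 1 / ((n : ℝ) + 1) from
      lt_add_of_pos_right _ Nat.one_div_pos_of_nat)
  have := bounds_nonneg c M hM
  have := bounds_nonneg z N hN
  refine (key M hM N hN).trans ?_
  gcongr

end ComplexInterp

end Complex

/-! ### Bilinear interpolation for real couples. -/

section Real

variable {A B X Y V W : Type*}
  [NormedAddCommGroup A] [NormedSpace ℝ A] [NormedAddCommGroup B] [NormedSpace ℝ B]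
  [NormedAddCommGroup X] [NormedSpace ℝ X] [NormedAddCommGroup Y] [NormedSpace ℝ Y]
  [NormedAddCommGroup V] [NormedSpace ℝ V] [NormedAddCommGroup W] [NormedSpace ℝ W]
  {i : A →L[ℝ] B} {j : X →L[ℝ] Y} {k : V →L[ℝ] W}

/-- Both sides expand into the same four real terms, to each of which `hST` applies. -/
theorem Complexification.bilin_map (S : A →L[ℝ] X →L[ℝ] V) (T : B →L[ℝ] Y →L[ℝ] W)
    (hST : ∀ a x, T (i a) (j x) = k (S a x)) (a : Complexification A) (x : Complexification X) :
    bilin T (map i a) (map j x) = map k (bilin S a x) := by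
  simp only [map_apply, bilin_apply, re_mk, im_mk, hST, map_add, map_sub]

namespace Interp

variable {θ : Set.Icc (0 : ℝ) 1}

theorem incl_toComplex (c : Interp i θ) :
    ComplexInterp.incl (toComplex c) = Complexification.ofReal (incl c) := rfl

theorem bilin_mem (S : A →L[ℝ] X →L[ℝ] V) (T : B →L[ℝ] Y →L[ℝ] W)
    (hST : ∀ a x, T (i a) (j x) = k (S a x)) (c : Interp i θ) (z : Interp j θ) :
    T (incl c) (incl z) ∈ realInterpSubmodule k θ := by
  have h := ComplexInterp.bilin_mem _ _ (Complexification.bilin_map S T hST)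
    (toComplex c) (toComplex z)
  rwa [incl_toComplex, incl_toComplex, Complexification.bilin_ofReal] at h

/-- Interpolation of a bounded bilinear map of couples of real spaces by the complex method. -/
def bilin (S : A →L[ℝ] X →L[ℝ] V) (T : B →L[ℝ] Y →L[ℝ] W)
    (hST : ∀ a x, T (i a) (j x) = k (S a x)) (θ : Set.Icc (0 : ℝ) 1) :
    Interp i θ →L[ℝ] Interp j θ →L[ℝ] Interp k θ :=
  LinearMap.mkContinuous₂
    (LinearMap.mk₂ ℝ (fun c z => (⟨T (incl c) (incl z), bilin_mem S T hST c z⟩ : Interp k θ))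
      (fun c c' z => Subtype.ext (by simp only [map_add, add_apply]; rfl))
      (fun r c z => Subtype.ext (by simp only [map_smul, smul_apply]; rfl))
      (fun c z z' => Subtype.ext (by simp only [map_add]; rfl))
      (fun r c z => Subtype.ext (by simp only [map_smul]; rfl)))
    -- The norms of the real spaces are by definition those of their images under `toComplex`, so
    -- the complex estimate applies verbatim, with the constant of the complexified maps.
    (max ‖Complexification.bilin S‖ ‖Complexification.bilin T‖) fun c z =>
      ComplexInterp.norm_le_of_incl_eq _ _ (Complexification.bilin_map S T hST)
        (toComplex c) (toComplex z) _ (Complexification.bilin_ofReal T _ _).symm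

theorem incl_bilin (S : A →L[ℝ] X →L[ℝ] V) (T : B →L[ℝ] Y →L[ℝ] W)
    (hST : ∀ a x, T (i a) (j x) = k (S a x)) (c : Interp i θ) (z : Interp j θ) :
    incl (bilin S T hST θ c z) = T (incl c) (incl z) := rfl

end Interp

end Real

end CxInterp

end

theorem theoremA1
    {A B X Y : Type*}
    [NormedAddCommGroup A] [NormedSpace ℝ A] [CompleteSpace A]
    [NormedAddCommGroup B] [NormedSpace ℝ B] [CompleteSpace B]
    [NormedAddCommGroup X] [NormedSpace ℝ X] [CompleteSpace X]
    [NormedAddCommGroup Y] [NormedSpace ℝ Y] [CompleteSpace Y]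
    -- the continuous and dense inclusions of `A` into `B` and of `X` into `Y`
    (i : A →L[ℝ] B) (hi : Function.Injective i) (hid : DenseRange i)
    (j : X →L[ℝ] Y) (hj : Function.Injective j) (hjd : DenseRange j)
    (Φ : A →L[ℝ] (X →L[ℝ] X)) (Ψ : B →L[ℝ] (Y →L[ℝ] Y))
    (hcompat : ∀ (a : A) (x : X), Ψ (i a) (j x) = j (Φ a x))
    (θ : Set.Icc (0 : ℝ) 1) :
    ∃ Ψθ : CxInterp.Interp i θ →L[ℝ] (CxInterp.Interp j θ →L[ℝ] CxInterp.Interp j θ),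
      ∀ (c : CxInterp.Interp i θ) (z : CxInterp.Interp j θ),
        CxInterp.Interp.incl (Ψθ c z) = Ψ (CxInterp.Interp.incl c) (CxInterp.Interp.incl z) := by
  -- The target couple is `j` itself: `V = X`, `W = Y`, `k = j`.
  exact ⟨CxInterp.Interp.bilin Φ Ψ hcompat θ, CxInterp.Interp.incl_bilin Φ Ψ hcompat⟩
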